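/- Let formulae be built from a set of propositional letters and the constants $\bot,\top$ by the binary connectives $\wedge,\vee,\cdot,\to,\leftarrow$. Formula structures are built from formulae by the binary structural operations $\odot$ and $\barwedge$ (there is no empty structure), and $\Gamma[\Delta]$ denotes a formula structure with a distinguished occurrence of a substructure $\Delta$, which may be the whole structure. Sequents have the form $\Gamma\Rightarrow A$ with $\Gamma$ a formula structure and $A$ a formula. The sequent calculus $\mathsf{L_{RBL}}$ has the axioms $$A\Rightarrow A,\qquad A\Rightarrow\top,\qquad \bot\Rightarrow A$$ and the following rules (premises before the slash, conclusion after it): - $(\to\mathrm L)$ $\ \Delta\Rightarrow A,\ \Gamma[B]\Rightarrow C\ /\ \Gamma[\Delta\odot(A\to B)]\Rightarrow C$; $\quad(\to\mathrm R)$ $\ A\odot\Gamma\Rightarrow B\ /\ \Gamma\Rightarrow A\to B$; - $(\leftarrow\mathrm L)$ $\ \Gamma[A]\Rightarrow C,\ \Delta\Rightarrow B\ /\ \Gamma[(A\leftarrow B)\odot\Delta]\Rightarrow C$; $\quad(\leftarrow\mathrm R)$ $\ \Gamma\odot B\Rightarrow A\ /\ \Gamma\Rightarrow A\leftarrow B$;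 - $(\cdot\,\mathrm L)$ $\ \Gamma[A\odot B]\Rightarrow C\ /\ \Gamma[A\cdot B]\Rightarrow C$; $\quad(\cdot\,\mathrm R)$ $\ \Gamma\Rightarrow A,\ \Delta\Rightarrow B\ /\ \Gamma\odot\Delta\Rightarrow A\cdot B$; - $(\wedge\mathrm L)$ $\ \Gamma[A\barwedge B]\Rightarrow C\ /\ \Gamma[A\wedge B]\Rightarrow C$; $\quad(\wedge\mathrm R)$ $\ \Gamma\Rightarrow A,\ \Gamma\Rightarrow B\ /\ \Gamma\Rightarrow A\wedge B$; - $(\vee\mathrm L)$ $\ \Gamma[A]\Rightarrow C,\ \Gamma[B]\Rightarrow C\ /\ \Gamma[A\vee B]\Rightarrow C$; $\quad(\vee\mathrm R)$ $\ \Gamma\Rightarrow A_i\ /\ \Gamma\Rightarrow A_1\vee A_2$ for $i\in\{1,2\}$; - contraction: $\ \Gamma[\Delta\barwedge\Delta]\Rightarrow A\ /\ \Gamma[\Delta]\Rightarrow A$ and $\ \Gamma[(\Lambda\odot\Delta)\odot\Delta]\Rightarrow A\ /\ \Gamma[\Lambda\odot\Delta]\Rightarrow A$; - exchange: $\ \Gamma[\Delta\barwedge\Lambda]\Rightarrow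 A\ /\ \Gamma[\Lambda\barwedge\Delta]\Rightarrow A$; - weakening, for $*\in\{\barwedge,\odot\}$: $\ \Gamma[\Delta]\Rightarrow A\ /\ \Gamma[\Delta'*\Delta]\Rightarrow A$ and $\ \Gamma[\Delta]\Rightarrow A\ /\ \Gamma[\Delta*\Delta']\Rightarrow A$; - associativity: $\ \Gamma[(\Delta_1\barwedge\Delta_2)\barwedge\Delta_3]\Rightarrow A\ /\ \Gamma[\Delta_1\barwedge(\Delta_2\barwedge\Delta_3)]\Rightarrow A$, and its converse; - (Cut) $\ \Delta\Rightarrow A,\ \Gamma[A]\Rightarrow B\ /\ \Gamma[\Delta]\Rightarrow B$. **Corollary (Subformula Property).** If a sequent $\Gamma\Rightarrow A$ is derivable in $\mathsf{L_{RBL}}$, then it has a derivation in $\mathsf{L_{RBL}}$ such that every formula occurring in (a sequent of) the derivation is $\top$, or $\bot$, or a subformula of a formula occurring in $\Gamma$, or a subformula of $A$. -/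

import Mathlib

namespace RBL

universe u

/-- Formulae of the language of residuated basic logic over a set `α` of propositional letters. -/
inductive Formula (α : Type u) : Type u
  | var (p : α) : Formula α
  | bot : Formula α
  | top : Formula α
  | and (A B : Formula α) : Formula α
  | or (A B : Formula α) : Formula α
  /-- the product `A · B` -/
  | prod (A B : Formula α) : Formula α
  /-- the basic implication `A → B` (right residual of the product) -/
  | imp (A B : Formula α) : Formula α
  /-- the left residual `A ← B` of the product -/
  | limp (A B : Formula α) : Formula α

/-- The set of subformulae of a formula (the formula itself included). -/
def Formula.subformulas {α : Type u} : Formula α → Set (Formula α)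
  | .var p => {.var p}
  | .bot => {.bot}
  | .top => {.top}
  | .and A B => {.and A B} ∪ A.subformulas ∪ B.subformulas
  | .or A B => {.or A B} ∪ A.subformulas ∪ B.subformulas
  | .prod A B => {.prod A B} ∪ A.subformulas ∪ B.subformulas
  | .imp A B => {.imp A B} ∪ A.subformulas ∪ B.subformulas
  | .limp A B => {.limp A B} ∪ A.subformulas ∪ B.subformulas

/-- Formula structures: binary trees of formulae built with `⊙` and `⩕`. There is no empty
structure. -/
inductive Struct (α : Type u) : Type u
  /-- a formula, seen as a structure -/
  | fm (A : Formula α) : Struct α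
  /-- `Γ ⊙ Δ` -/
  | odot (Γ Δ : Struct α) : Struct α
  /-- `Γ ⩕ Δ` -/
  | owedge (Γ Δ : Struct α) : Struct α

/-- The formulae that a formula structure is built from. -/
def Struct.formulas {α : Type u} : Struct α → Set (Formula α)
  | .fm A => {A}
  | .odot Γ Δ => Γ.formulas ∪ Δ.formulas
  | .owedge Γ Δ => Γ.formulas ∪ Δ.formulas

/-- Contexts `Γ[-]`: formula structures with exactly one hole. -/
inductive Ctx (α : Type u) : Type u
  | hole : Ctx α
  | odotL (c : Ctx α) (Δ : Struct α) : Ctx α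
  | odotR (Δ : Struct α) (c : Ctx α) : Ctx α
  | owedgeL (c : Ctx α) (Δ : Struct α) : Ctx α
  | owedgeR (Δ : Struct α) (c : Ctx α) : Ctx α

/-- `c.fill Δ` is the structure `Γ[Δ]` obtained by putting `Δ` in the hole of `c = Γ[-]`. -/
def Ctx.fill {α : Type u} : Ctx α → Struct α → Struct α
  | .hole, Θ => Θ
  | .odotL c Δ, Θ => .odot (c.fill Θ) Δ
  | .odotR Δ c, Θ => .odot Δ (c.fill Θ)
  | .owedgeL c Δ, Θ => .owedge (c.fill Θ) Δ
  | .owedgeR Δ c, Θ => .owedge Δ (c.fill Θ)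

/-- Sequents `Γ ⇒ A`. -/
structure Sequent (α : Type u) : Type u where
  ant : Struct α
  suc : Formula α

/-- The formulae occurring in a sequent. -/
def Sequent.formulas {α : Type u} (s : Sequent α) : Set (Formula α) :=
  s.ant.formulas ∪ {s.suc}

/-- Derivation trees of the sequent calculus `L_RBL`; `Derivation Γ A` is the type of derivations
with end sequent `Γ ⇒ A`. -/
inductive Derivation {α : Type u} : Struct α → Formula α → Type u
  | id (A : Formula α) : Derivation (.fm A) A
  | top (A : Formula α) : Derivation (.fm A) .top
  | bot (A : Formula α) : Derivation (.fm .bot) A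
  | impL (c : Ctx α) (Δ : Struct α) (A B C : Formula α) :
      Derivation Δ A → Derivation (c.fill (.fm B)) C →
      Derivation (c.fill (.odot Δ (.fm (.imp A B)))) C
  | impR (Γ : Struct α) (A B : Formula α) :
      Derivation (.odot (.fm A) Γ) B → Derivation Γ (.imp A B)
  | limpL (c : Ctx α) (Δ : Struct α) (A B C : Formula α) :
      Derivation (c.fill (.fm A)) C → Derivation Δ B →
      Derivation (c.fill (.odot (.fm (.limp A B)) Δ)) C
  | limpR (Γ : Struct α) (A B : Formula α) :
      Derivation (.odot Γ (.fm B)) A → Derivation Γ (.limp A B)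
  | prodL (c : Ctx α) (A B C : Formula α) :
      Derivation (c.fill (.odot (.fm A) (.fm B))) C → Derivation (c.fill (.fm (.prod A B))) C
  | prodR (Γ Δ : Struct α) (A B : Formula α) :
      Derivation Γ A → Derivation Δ B → Derivation (.odot Γ Δ) (.prod A B)
  | andL (c : Ctx α) (A B C : Formula α) :
      Derivation (c.fill (.owedge (.fm A) (.fm B))) C → Derivation (c.fill (.fm (.and A B))) C
  | andR (Γ : Struct α) (A B : Formula α) :
      Derivation Γ A → Derivation Γ B → Derivation Γ (.and A B)
  | orL (c : Ctx α) (A B C : Formula α) :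
      Derivation (c.fill (.fm A)) C → Derivation (c.fill (.fm B)) C →
      Derivation (c.fill (.fm (.or A B))) C
  | orR₁ (Γ : Struct α) (A B : Formula α) : Derivation Γ A → Derivation Γ (.or A B)
  | orR₂ (Γ : Struct α) (A B : Formula α) : Derivation Γ B → Derivation Γ (.or A B)
  | owedgeC (c : Ctx α) (Δ : Struct α) (A : Formula α) :
      Derivation (c.fill (.owedge Δ Δ)) A → Derivation (c.fill Δ) A
  | odotC (c : Ctx α) (Λ Δ : Struct α) (A : Formula α) :
      Derivation (c.fill (.odot (.odot Λ Δ) Δ)) A → Derivation (c.fill (.odot Λ Δ)) A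
  | owedgeE (c : Ctx α) (Δ Λ : Struct α) (A : Formula α) :
      Derivation (c.fill (.owedge Δ Λ)) A → Derivation (c.fill (.owedge Λ Δ)) A
  | cut (c : Ctx α) (Δ : Struct α) (A B : Formula α) :
      Derivation Δ A → Derivation (c.fill (.fm A)) B → Derivation (c.fill Δ) B
  | owedgeW₁ (c : Ctx α) (Δ' Δ : Struct α) (A : Formula α) :
      Derivation (c.fill Δ) A → Derivation (c.fill (.owedge Δ' Δ)) A
  | odotW₁ (c : Ctx α) (Δ' Δ : Struct α) (A : Formula α) :
      Derivation (c.fill Δ) A → Derivation (c.fill (.odot Δ' Δ)) A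
  | owedgeW₂ (c : Ctx α) (Δ Δ' : Struct α) (A : Formula α) :
      Derivation (c.fill Δ) A → Derivation (c.fill (.owedge Δ Δ')) A
  | odotW₂ (c : Ctx α) (Δ Δ' : Struct α) (A : Formula α) :
      Derivation (c.fill Δ) A → Derivation (c.fill (.odot Δ Δ')) A
  | owedgeA₁ (c : Ctx α) (Δ₁ Δ₂ Δ₃ : Struct α) (A : Formula α) :
      Derivation (c.fill (.owedge (.owedge Δ₁ Δ₂) Δ₃)) A →
      Derivation (c.fill (.owedge Δ₁ (.owedge Δ₂ Δ₃))) A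
  | owedgeA₂ (c : Ctx α) (Δ₁ Δ₂ Δ₃ : Struct α) (A : Formula α) :
      Derivation (c.fill (.owedge Δ₁ (.owedge Δ₂ Δ₃))) A →
      Derivation (c.fill (.owedge (.owedge Δ₁ Δ₂) Δ₃)) A

/-- The set of formulae occurring in a derivation, i.e. in one of the sequents at its nodes: those
of the end sequent, and those of the derivations of the premises of the last rule. -/
def Derivation.formulas {α : Type u} {Γ : Struct α} {A : Formula α} (d : Derivation Γ A) :
    Set (Formula α) :=
  (Sequent.mk Γ A).formulas ∪
  match d with
  | .id _ | .top _ | .bot _ => ∅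
  | .impL _ _ _ _ _ d₁ d₂ | .limpL _ _ _ _ _ d₁ d₂ | .prodR _ _ _ _ d₁ d₂
  | .andR _ _ _ d₁ d₂ | .orL _ _ _ _ d₁ d₂ | .cut _ _ _ _ d₁ d₂ => d₁.formulas ∪ d₂.formulas
  | .impR _ _ _ d₁ | .limpR _ _ _ d₁ | .prodL _ _ _ _ d₁ | .andL _ _ _ _ d₁
  | .orR₁ _ _ _ d₁ | .orR₂ _ _ _ d₁ | .owedgeC _ _ _ d₁ | .odotC _ _ _ _ d₁
  | .owedgeE _ _ _ _ d₁ | .owedgeW₁ _ _ _ _ d₁ | .odotW₁ _ _ _ _ d₁ | .owedgeW₂ _ _ _ _ d₁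
  | .odotW₂ _ _ _ _ d₁ | .owedgeA₁ _ _ _ _ _ d₁ | .owedgeA₂ _ _ _ _ _ d₁ => d₁.formulas

/-- `Γ ⇒ A` is derivable in `L_RBL`. -/
def Derivable {α : Type u} (Γ : Struct α) (A : Formula α) : Prop :=
  Nonempty (Derivation Γ A)

end RBL

namespace RBL

variable {α : Type*}

/-! This is semantic cut elimination. Call a sequent analytic if it has a derivation using only its
own subformulae. Analytic sequents are closed under the rules needed below, none of which is cut.
The relation "`c[Γ] ⇒ C` is analytic" between structures `Γ` and pairs `(c, C)` is a Galois
connection, whose closed sets of structures model the calculus: `⩕` is intersection, `⊙` the closure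
of the elementwise product, and the implications are its residuals.

Two facts meet in this model. By induction on `A`, the interpretation of `A` contains `A` and only
structures that derive `A` analytically (`Formula.mem_interp_and_interp_subset`). And every
derivable `Γ ⇒ A` gives an inclusion of interpretations (`Derivation.interp_subset`), where cut is
transitivity of inclusion. Since `Γ` lies in its own interpretation (`Struct.mem_interp`), it lies
in that of `A`, so `Γ ⇒ A` is analytic. -/

theorem Formula.self_mem_subformulas (A : Formula α) : A ∈ A.subformulas := by
  cases A <;> simp [Formula.subformulas]

theorem Formula.subformulas_subset {A B : Formula α} (h : A ∈ B.subformulas) :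
    A.subformulas ⊆ B.subformulas := by
  induction B with
  | var p => cases h; exact subset_rfl
  | bot => cases h; exact subset_rfl
  | top => cases h; exact subset_rfl
  | and C D hC hD | or C D hC hD | prod C D hC hD | imp C D hC hD | limp C D hC hD =>
    rcases h with (h | h) | h
    · cases h; exact subset_rfl
    · exact (hC h).trans fun x hx => .inl (.inr hx)
    · exact (hD h).trans fun x hx => .inr hx

/-- The formulae occurring in a context. -/
def Ctx.formulas : Ctx α → Set (Formula α)
  | .hole => ∅
  | .odotL c Δ | .odotR Δ c | .owedgeL c Δ | .owedgeR Δ c => c.formulas ∪ Δ.formulas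

theorem Ctx.formulas_fill (c : Ctx α) (Θ : Struct α) :
    (c.fill Θ).formulas = c.formulas ∪ Θ.formulas := by
  induction c <;> simp only [Ctx.fill, Ctx.formulas, Struct.formulas, Set.empty_union, *] <;> grind

/-- Composition of contexts: `c.comp e` is `c[e[-]]`. -/
def Ctx.comp : Ctx α → Ctx α → Ctx α
  | .hole, e => e
  | .odotL c Δ, e => .odotL (c.comp e) Δ
  | .odotR Δ c, e => .odotR Δ (c.comp e)
  | .owedgeL c Δ, e => .owedgeL (c.comp e) Δ
  | .owedgeR Δ c, e => .owedgeR Δ (c.comp e)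

theorem Ctx.fill_comp (c e : Ctx α) (Θ : Struct α) : (c.comp e).fill Θ = c.fill (e.fill Θ) := by
  induction c <;> simp_all [Ctx.fill, Ctx.comp]

/-- The subformulae of the formulae of a sequent. -/
def Sequent.subformulas (s : Sequent α) : Set (Formula α) :=
  {B | ∃ C ∈ s.formulas, B ∈ C.subformulas}

theorem Sequent.formulas_subset_subformulas (s : Sequent α) : s.formulas ⊆ s.subformulas :=
  fun B hB => ⟨B, hB, B.self_mem_subformulas⟩

theorem Sequent.subformulas_subset {s t : Sequent α} (h : s.formulas ⊆ t.subformulas) :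
    s.subformulas ⊆ t.subformulas := by
  rintro B ⟨C, hC, hB⟩
  obtain ⟨D, hD, hCD⟩ := h hC
  exact ⟨D, hD, Formula.subformulas_subset hCD hB⟩

/-- A sequent has an analytic derivation if it is derivable using only its own subformulae. -/
def Analytic (Γ : Struct α) (A : Formula α) : Prop :=
  ∃ d : Derivation Γ A, d.formulas ⊆ (Sequent.mk Γ A).subformulas

theorem Analytic.of_unary {Γ Δ : Struct α} {A B : Formula α} (f : Derivation Γ A → Derivation Δ B)
    (hf : ∀ d, (f d).formulas = (Sequent.mk Δ B).formulas ∪ d.formulas)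
    (hs : (Sequent.mk Γ A).formulas ⊆ (Sequent.mk Δ B).subformulas) (h : Analytic Γ A) :
    Analytic Δ B := by
  obtain ⟨d, hd⟩ := h
  refine ⟨f d, ?_⟩
  rw [hf]
  exact Set.union_subset (Sequent.formulas_subset_subformulas _)
    (hd.trans (Sequent.subformulas_subset hs))

theorem Analytic.of_binary {Γ₁ Γ₂ Δ : Struct α} {A₁ A₂ B : Formula α}
    (f : Derivation Γ₁ A₁ → Derivation Γ₂ A₂ → Derivation Δ B)
    (hf : ∀ d e, (f d e).formulas = (Sequent.mk Δ B).formulas ∪ (d.formulas ∪ e.formulas))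
    (hs₁ : (Sequent.mk Γ₁ A₁).formulas ⊆ (Sequent.mk Δ B).subformulas)
    (hs₂ : (Sequent.mk Γ₂ A₂).formulas ⊆ (Sequent.mk Δ B).subformulas)
    (h₁ : Analytic Γ₁ A₁) (h₂ : Analytic Γ₂ A₂) : Analytic Δ B := by
  obtain ⟨d, hd⟩ := h₁
  obtain ⟨e, he⟩ := h₂
  refine ⟨f d e, ?_⟩
  rw [hf]
  exact Set.union_subset (Sequent.formulas_subset_subformulas _)
    (Set.union_subset (hd.trans (Sequent.subformulas_subset hs₁))
      (he.trans (Sequent.subformulas_subset hs₂)))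

theorem Analytic.of_initial {Γ : Struct α} {A : Formula α} (d : Derivation Γ A)
    (hd : d.formulas = (Sequent.mk Γ A).formulas ∪ ∅) : Analytic Γ A :=
  ⟨d, by rw [hd, Set.union_empty]; exact Sequent.formulas_subset_subformulas _⟩

theorem Sequent.formulas_subset_of_forall {Γ Δ : Struct α} {A B : Formula α}
    (h : ∀ C, C ∈ Γ.formulas ∨ C = A →
      C ∈ Δ.formulas ∨ C = B ∨ (∃ D ∈ Δ.formulas, C ∈ D.subformulas) ∨ C ∈ B.subformulas) :
    (Sequent.mk Γ A).formulas ⊆ (Sequent.mk Δ B).subformulas := by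
  intro C hC
  rcases h C hC with h | h | ⟨D, hD, h⟩ | h
  · exact ⟨C, .inl h, C.self_mem_subformulas⟩
  · exact ⟨C, .inr h, C.self_mem_subformulas⟩
  · exact ⟨D, .inl hD, h⟩
  · exact ⟨B, .inr rfl, h⟩

/-! ### Rules that preserve analyticity -/

namespace Analytic

theorem impL (c : Ctx α) {Δ : Struct α} {A B C : Formula α}
    (h₁ : Analytic Δ A) (h₂ : Analytic (c.fill (.fm B)) C) :
    Analytic (c.fill (.odot Δ (.fm (.imp A B)))) C := by
  refine of_binary (.impL c Δ A B C) (fun _ _ => rfl) ?_ ?_ h₁ h₂ <;>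
  · refine Sequent.formulas_subset_of_forall fun D hD => ?_
    simp only [Ctx.formulas_fill, Struct.formulas, Set.mem_union, Set.mem_singleton_iff] at hD ⊢
    grind [Formula.subformulas, Formula.self_mem_subformulas]

theorem limpL (c : Ctx α) {Δ : Struct α} {A B C : Formula α}
    (h₁ : Analytic (c.fill (.fm A)) C) (h₂ : Analytic Δ B) :
    Analytic (c.fill (.odot (.fm (.limp A B)) Δ)) C := by
  refine of_binary (.limpL c Δ A B C) (fun _ _ => rfl) ?_ ?_ h₁ h₂ <;>
  · refine Sequent.formulas_subset_of_forall fun D hD => ?_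
    simp only [Ctx.formulas_fill, Struct.formulas, Set.mem_union, Set.mem_singleton_iff] at hD ⊢
    grind [Formula.subformulas, Formula.self_mem_subformulas]

theorem impR {Γ : Struct α} {A B : Formula α}
    (h : Analytic (.odot (.fm A) Γ) B) :
    Analytic Γ (.imp A B) := by
  refine of_unary (.impR Γ A B) (fun _ => rfl) ?_ h
  refine Sequent.formulas_subset_of_forall fun D hD => ?_
  simp only [Struct.formulas, Set.mem_union, Set.mem_singleton_iff] at hD ⊢
  grind [Formula.subformulas, Formula.self_mem_subformulas]

theorem limpR {Γ : Struct α} {A B : Formula α}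
    (h : Analytic (.odot Γ (.fm B)) A) :
    Analytic Γ (.limp A B) := by
  refine of_unary (.limpR Γ A B) (fun _ => rfl) ?_ h
  refine Sequent.formulas_subset_of_forall fun D hD => ?_
  simp only [Struct.formulas, Set.mem_union, Set.mem_singleton_iff] at hD ⊢
  grind [Formula.subformulas, Formula.self_mem_subformulas]

theorem prodL (c : Ctx α) {A B C : Formula α}
    (h : Analytic (c.fill (.odot (.fm A) (.fm B))) C) :
    Analytic (c.fill (.fm (.prod A B))) C := by
  refine of_unary (.prodL c A B C) (fun _ => rfl) ?_ h
  refine Sequent.formulas_subset_of_forall fun D hD => ?_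
  simp only [Ctx.formulas_fill, Struct.formulas, Set.mem_union, Set.mem_singleton_iff] at hD ⊢
  grind [Formula.subformulas, Formula.self_mem_subformulas]

theorem andL (c : Ctx α) {A B C : Formula α}
    (h : Analytic (c.fill (.owedge (.fm A) (.fm B))) C) :
    Analytic (c.fill (.fm (.and A B))) C := by
  refine of_unary (.andL c A B C) (fun _ => rfl) ?_ h
  refine Sequent.formulas_subset_of_forall fun D hD => ?_
  simp only [Ctx.formulas_fill, Struct.formulas, Set.mem_union, Set.mem_singleton_iff] at hD ⊢
  grind [Formula.subformulas, Formula.self_mem_subformulas]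

theorem prodR {Γ Δ : Struct α} {A B : Formula α}
    (h₁ : Analytic Γ A) (h₂ : Analytic Δ B) :
    Analytic (.odot Γ Δ) (.prod A B) := by
  refine of_binary (.prodR Γ Δ A B) (fun _ _ => rfl) ?_ ?_ h₁ h₂ <;>
  · refine Sequent.formulas_subset_of_forall fun D hD => ?_
    simp only [Struct.formulas, Set.mem_union] at hD ⊢
    grind [Formula.subformulas, Formula.self_mem_subformulas]

theorem andR {Γ : Struct α} {A B : Formula α}
    (h₁ : Analytic Γ A) (h₂ : Analytic Γ B) :
    Analytic Γ (.and A B) := by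
  refine of_binary (.andR Γ A B) (fun _ _ => rfl) ?_ ?_ h₁ h₂ <;>
  · refine Sequent.formulas_subset_of_forall fun D hD => ?_
    grind [Formula.subformulas, Formula.self_mem_subformulas]

theorem orL (c : Ctx α) {A B C : Formula α}
    (h₁ : Analytic (c.fill (.fm A)) C) (h₂ : Analytic (c.fill (.fm B)) C) :
    Analytic (c.fill (.fm (.or A B))) C := by
  refine of_binary (.orL c A B C) (fun _ _ => rfl) ?_ ?_ h₁ h₂ <;>
  · refine Sequent.formulas_subset_of_forall fun D hD => ?_
    simp only [Ctx.formulas_fill, Struct.formulas, Set.mem_union, Set.mem_singleton_iff] at hD ⊢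
    grind [Formula.subformulas, Formula.self_mem_subformulas]

theorem orR₁ {Γ : Struct α} {A B : Formula α}
    (h : Analytic Γ A) :
    Analytic Γ (.or A B) := by
  refine of_unary (.orR₁ Γ A B) (fun _ => rfl) ?_ h
  refine Sequent.formulas_subset_of_forall fun D hD => ?_
  grind [Formula.subformulas, Formula.self_mem_subformulas]

theorem orR₂ {Γ : Struct α} {A B : Formula α}
    (h : Analytic Γ B) :
    Analytic Γ (.or A B) := by
  refine of_unary (.orR₂ Γ A B) (fun _ => rfl) ?_ h
  refine Sequent.formulas_subset_of_forall fun D hD => ?_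
  grind [Formula.subformulas, Formula.self_mem_subformulas]

theorem owedgeC (c : Ctx α) {Δ : Struct α} {C : Formula α}
    (h : Analytic (c.fill (.owedge Δ Δ)) C) :
    Analytic (c.fill Δ) C := by
  refine of_unary (.owedgeC c Δ C) (fun _ => rfl) ?_ h
  refine Sequent.formulas_subset_of_forall fun D hD => ?_
  simp only [Ctx.formulas_fill, Struct.formulas, Set.mem_union] at hD ⊢
  grind [Formula.subformulas, Formula.self_mem_subformulas]

theorem odotC (c : Ctx α) {Λ Δ : Struct α} {C : Formula α}
    (h : Analytic (c.fill (.odot (.odot Λ Δ) Δ)) C) :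
    Analytic (c.fill (.odot Λ Δ)) C := by
  refine of_unary (.odotC c Λ Δ C) (fun _ => rfl) ?_ h
  refine Sequent.formulas_subset_of_forall fun D hD => ?_
  simp only [Ctx.formulas_fill, Struct.formulas, Set.mem_union] at hD ⊢
  grind [Formula.subformulas, Formula.self_mem_subformulas]

theorem owedgeW₁ (c : Ctx α) (Δ' : Struct α) {Δ : Struct α} {C : Formula α}
    (h : Analytic (c.fill Δ) C) :
    Analytic (c.fill (.owedge Δ' Δ)) C := by
  refine of_unary (.owedgeW₁ c Δ' Δ C) (fun _ => rfl) ?_ h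
  refine Sequent.formulas_subset_of_forall fun D hD => ?_
  simp only [Ctx.formulas_fill, Struct.formulas, Set.mem_union] at hD ⊢
  grind [Formula.subformulas, Formula.self_mem_subformulas]

theorem owedgeW₂ (c : Ctx α) {Δ : Struct α} (Δ' : Struct α) {C : Formula α}
    (h : Analytic (c.fill Δ) C) :
    Analytic (c.fill (.owedge Δ Δ')) C := by
  refine of_unary (.owedgeW₂ c Δ Δ' C) (fun _ => rfl) ?_ h
  refine Sequent.formulas_subset_of_forall fun D hD => ?_
  simp only [Ctx.formulas_fill, Struct.formulas, Set.mem_union] at hD ⊢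
  grind [Formula.subformulas, Formula.self_mem_subformulas]

theorem odotW₁ (c : Ctx α) (Δ' : Struct α) {Δ : Struct α} {C : Formula α}
    (h : Analytic (c.fill Δ) C) :
    Analytic (c.fill (.odot Δ' Δ)) C := by
  refine of_unary (.odotW₁ c Δ' Δ C) (fun _ => rfl) ?_ h
  refine Sequent.formulas_subset_of_forall fun D hD => ?_
  simp only [Ctx.formulas_fill, Struct.formulas, Set.mem_union] at hD ⊢
  grind [Formula.subformulas, Formula.self_mem_subformulas]

theorem odotW₂ (c : Ctx α) {Δ : Struct α} (Δ' : Struct α) {C : Formula α}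
    (h : Analytic (c.fill Δ) C) :
    Analytic (c.fill (.odot Δ Δ')) C := by
  refine of_unary (.odotW₂ c Δ Δ' C) (fun _ => rfl) ?_ h
  refine Sequent.formulas_subset_of_forall fun D hD => ?_
  simp only [Ctx.formulas_fill, Struct.formulas, Set.mem_union] at hD ⊢
  grind [Formula.subformulas, Formula.self_mem_subformulas]

/-- The axiom covers a single formula on the left; weakening builds up the rest of the structure.
`bot_left` builds up the context in the same way. -/
theorem top_right (Γ : Struct α) : Analytic Γ .top := by
  induction Γ with
  | fm A => exact of_initial (.top A) rfl
  | odot Γ Δ h _ => exact odotW₂ .hole Δ h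
  | owedge Γ Δ h _ => exact owedgeW₂ .hole Δ h

theorem bot_left (c : Ctx α) (C : Formula α) : Analytic (c.fill (.fm .bot)) C := by
  induction c with
  | hole => exact of_initial (.bot C) rfl
  | odotL c Δ h => exact odotW₂ .hole Δ h
  | odotR Δ c h => exact odotW₁ .hole Δ h
  | owedgeL c Δ h => exact owedgeW₂ .hole Δ h
  | owedgeR Δ c h => exact owedgeW₁ .hole Δ h

end Analytic

/-! ### Closed sets of structures -/

/-- The closure of a set of structures under the Galois connection between structures and
pairs of a context and a formula induced by `Analytic`. -/
def cl (X : Set (Struct α)) : Set (Struct α) :=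
  {Γ | ∀ (c : Ctx α) (C : Formula α), (∀ Δ ∈ X, Analytic (c.fill Δ) C) → Analytic (c.fill Γ) C}

/-- The sets of structures that are closed for `cl`. -/
def IsCl (X : Set (Struct α)) : Prop := cl X ⊆ X

theorem subset_cl (X : Set (Struct α)) : X ⊆ cl X := fun _ hΓ _ _ h =>
  h _ hΓ

theorem isCl_cl (X : Set (Struct α)) : IsCl (cl X) :=
  fun _ hΓ c C h => hΓ c C fun _ hΔ => hΔ c C h

theorem IsCl.cl_subset {X Y : Set (Struct α)} (hY : IsCl Y) (h : X ⊆ Y) : cl X ⊆ Y :=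
  fun _ hΓ => hY fun c C hc => hΓ c C fun _ hΔ => hc _ (h hΔ)

theorem IsCl.inter {X Y : Set (Struct α)} (hX : IsCl X) (hY : IsCl Y) : IsCl (X ∩ Y) :=
  fun _ hΓ => ⟨hX fun c C h => hΓ c C fun _ hΔ => h _ hΔ.1,
    hY fun c C h => hΓ c C fun _ hΔ => h _ hΔ.2⟩

theorem isCl_setOf_analytic (A : Formula α) : IsCl {Γ : Struct α | Analytic Γ A} :=
  fun _ hΓ => hΓ .hole A fun _ hΔ => hΔ

/-- Membership in a closed set may be tested by replacing a structure in every context. -/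
theorem IsCl.mem_of_forall {X : Set (Struct α)} (hX : IsCl X) {Γ Δ : Struct α} (hΓ : Γ ∈ X)
    (h : ∀ (c : Ctx α) C, Analytic (c.fill Γ) C → Analytic (c.fill Δ) C) : Δ ∈ X :=
  hX fun c C hc => h c C (hc _ hΓ)

/-- A test context `c` around `(e Δ)[Γ]` is the test context `c.comp (e Δ)` around `Γ`. This makes
residuals of closed sets closed, both for the implications and for filling a context. -/
theorem IsCl.preimage {X Y : Set (Struct α)} (hX : IsCl X) (e : Struct α → Ctx α) :
    IsCl {Γ | ∀ Δ ∈ Y, (e Δ).fill Γ ∈ X} := by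
  intro Γ hΓ Δ hΔ
  refine hX fun c C hc => ?_
  rw [← Ctx.fill_comp]
  refine hΓ _ C fun Θ hΘ => ?_
  rw [Ctx.fill_comp]
  exact hc _ (hΘ Δ hΔ)

/-! ### Interpretation of formulae and structures -/

/-- The closed set of structures interpreting a formula. -/
def Formula.interp : Formula α → Set (Struct α)
  | .var p => {Γ | Analytic Γ (.var p)}
  | .bot => cl ∅
  | .top => Set.univ
  | .and A B => A.interp ∩ B.interp
  | .or A B => cl (A.interp ∪ B.interp)
  | .prod A B => cl (Set.image2 .odot A.interp B.interp)
  | .imp A B => {Γ | ∀ Δ ∈ A.interp, (Ctx.odotR Δ .hole).fill Γ ∈ B.interp}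
  | .limp A B => {Γ | ∀ Δ ∈ B.interp, (Ctx.odotL .hole Δ).fill Γ ∈ A.interp}

theorem Formula.isCl_interp (A : Formula α) : IsCl A.interp := by
  induction A with
  | var p => exact isCl_setOf_analytic _
  | bot => exact isCl_cl _
  | top => exact Set.subset_univ _
  | and A B hA hB => exact hA.inter hB
  | or A B => exact isCl_cl _
  | prod A B => exact isCl_cl _
  | imp A B _ hB => exact hB.preimage fun Δ => .odotR Δ .hole
  | limp A B hA _ => exact hA.preimage fun Δ => .odotL .hole Δ

/-- The interpretation of a formula contains the formula and consists of structures from which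
the formula is analytically derivable. -/
theorem Formula.mem_interp_and_interp_subset (A : Formula α) :
    .fm A ∈ A.interp ∧ ∀ Γ ∈ A.interp, Analytic Γ A := by
  induction A with
  | var p => exact ⟨.of_initial (.id _) rfl, fun _ h => h⟩
  -- Membership in `cl ∅` means deriving every formula in every context.
  | bot => exact ⟨fun c C _ => .bot_left c C, fun Γ h => h .hole _ (by simp)⟩
  | top => exact ⟨trivial, fun Γ _ => .top_right Γ⟩
  | and A B hA hB =>
    exact ⟨⟨A.isCl_interp.mem_of_forall hA.1 fun c _ h => .andL c (.owedgeW₂ c _ h),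
      B.isCl_interp.mem_of_forall hB.1 fun c _ h => .andL c (.owedgeW₁ c _ h)⟩,
      fun Γ h => .andR (hA.2 Γ h.1) (hB.2 Γ h.2)⟩
  | or A B hA hB =>
    refine ⟨fun c C h => .orL c (h _ (.inl hA.1)) (h _ (.inr hB.1)), fun Γ h => h .hole _ ?_⟩
    rintro Δ (hΔ | hΔ)
    · exact .orR₁ (hA.2 Δ hΔ)
    · exact .orR₂ (hB.2 Δ hΔ)
  | prod A B hA hB =>
    refine ⟨fun c C h => .prodL c (h _ ⟨_, hA.1, _, hB.1, rfl⟩), fun Γ h => h .hole _ ?_⟩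
    rintro _ ⟨Δ, hΔ, Λ, hΛ, rfl⟩
    exact .prodR (hA.2 Δ hΔ) (hB.2 Λ hΛ)
  | imp A B hA hB =>
    -- Both halves of the induction hypothesis are used crosswise: the left rule needs `Δ ⇒ A`
    -- analytic, and the right rule tests `Γ` on the formula `A` itself.
    exact ⟨fun Δ hΔ => B.isCl_interp.mem_of_forall hB.1 fun c _ h => .impL c (hA.2 Δ hΔ) h,
      fun Γ h => .impR (hB.2 _ (h _ hA.1))⟩
  | limp A B hA hB =>
    exact ⟨fun Δ hΔ => A.isCl_interp.mem_of_forall hA.1 fun c _ h => .limpL c h (hB.2 Δ hΔ),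
      fun Γ h => .limpR (hA.2 _ (h _ hB.1))⟩

/-- The closed set of structures interpreting a structure. -/
def Struct.interp : Struct α → Set (Struct α)
  | .fm A => A.interp
  | .odot Γ Δ => cl (Set.image2 .odot Γ.interp Δ.interp)
  | .owedge Γ Δ => Γ.interp ∩ Δ.interp

theorem Struct.isCl_interp (Γ : Struct α) : IsCl Γ.interp := by
  induction Γ with
  | fm A => exact A.isCl_interp
  | odot Γ Δ => exact isCl_cl _
  | owedge Γ Δ hΓ hΔ => exact hΓ.inter hΔ

theorem Struct.mem_interp (Γ : Struct α) : Γ ∈ Γ.interp := by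
  induction Γ with
  | fm A => exact A.mem_interp_and_interp_subset.1
  | odot Γ Δ hΓ hΔ => exact subset_cl _ ⟨_, hΓ, _, hΔ, rfl⟩
  | owedge Γ Δ hΓ hΔ =>
    exact ⟨Γ.isCl_interp.mem_of_forall hΓ fun c _ h => .owedgeW₂ c _ h,
      Δ.isCl_interp.mem_of_forall hΔ fun c _ h => .owedgeW₁ c _ h⟩

theorem Struct.interp_odot_subset_iff {Γ Δ : Struct α} {Z : Set (Struct α)} (hZ : IsCl Z) :
    (Struct.odot Γ Δ).interp ⊆ Z ↔ ∀ x ∈ Γ.interp, ∀ y ∈ Δ.interp, .odot x y ∈ Z :=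
  ⟨fun h _ hx _ hy => h (subset_cl _ ⟨_, hx, _, hy, rfl⟩), fun h => hZ.cl_subset <| by
    rintro _ ⟨x, hx, y, hy, rfl⟩
    exact h x hx y hy⟩

/-- Weakening puts `x ⩕ y` into both interpretations, and contraction recovers `x` from `x ⩕ x`. So
intersection behaves like a closed product and, like `⊙`, has residuals. -/
theorem Struct.interp_owedge_subset_iff {Γ Δ : Struct α} {Z : Set (Struct α)} (hZ : IsCl Z) :
    (Struct.owedge Γ Δ).interp ⊆ Z ↔ ∀ x ∈ Γ.interp, ∀ y ∈ Δ.interp, .owedge x y ∈ Z :=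
  ⟨fun h _ hx _ hy => h ⟨Γ.isCl_interp.mem_of_forall hx fun c _ h => .owedgeW₂ c _ h,
      Δ.isCl_interp.mem_of_forall hy fun c _ h => .owedgeW₁ c _ h⟩,
    fun h x hx => hZ.mem_of_forall (h x hx.1 x hx.2) fun c _ h => .owedgeC c h⟩

/-- Filling a context is residuated with respect to the interpretation. -/
theorem Ctx.exists_residual (c : Ctx α) {Z : Set (Struct α)} (hZ : IsCl Z) :
    ∃ R, IsCl R ∧ ∀ Δ : Struct α, (c.fill Δ).interp ⊆ Z ↔ Δ.interp ⊆ R := by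
  induction c generalizing Z with
  | hole => exact ⟨Z, hZ, fun _ => Iff.rfl⟩
  | odotL c Θ ih =>
    -- The outermost operation is moved into `Z`: the induction hypothesis is applied to the closed
    -- set of all `x` with `x ⊙ y ∈ Z` for every `y` interpreting `Θ`.
    obtain ⟨R, hR, h⟩ := ih (hZ.preimage (Y := Θ.interp) fun y => .odotL .hole y)
    exact ⟨R, hR, fun Δ => (Struct.interp_odot_subset_iff hZ).trans (h Δ)⟩
  | odotR Θ c ih =>
    obtain ⟨R, hR, h⟩ := ih (hZ.preimage (Y := Θ.interp) fun y => .odotR y .hole)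
    exact ⟨R, hR, fun Δ => (Struct.interp_odot_subset_iff hZ).trans
      (Iff.trans ⟨fun h x hx y hy => h y hy x hx, fun h x hx y hy => h y hy x hx⟩ (h Δ))⟩
  | owedgeL c Θ ih =>
    obtain ⟨R, hR, h⟩ := ih (hZ.preimage (Y := Θ.interp) fun y => .owedgeL .hole y)
    exact ⟨R, hR, fun Δ => (Struct.interp_owedge_subset_iff hZ).trans (h Δ)⟩
  | owedgeR Θ c ih =>
    obtain ⟨R, hR, h⟩ := ih (hZ.preimage (Y := Θ.interp) fun y => .owedgeR y .hole)
    exact ⟨R, hR, fun Δ => (Struct.interp_owedge_subset_iff hZ).trans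
      (Iff.trans ⟨fun h x hx y hy => h y hy x hx, fun h x hx y hy => h y hy x hx⟩ (h Δ))⟩

/-- Residuation with `Z` the interpretation of `c[Δ]` itself. -/
theorem Ctx.interp_fill_mono (c : Ctx α) {Γ Δ : Struct α} (h : Γ.interp ⊆ Δ.interp) :
    (c.fill Γ).interp ⊆ (c.fill Δ).interp := by
  obtain ⟨R, -, hR⟩ := c.exists_residual (c.fill Δ).isCl_interp
  exact (hR Γ).2 (h.trans ((hR Δ).1 subset_rfl))

/-! ### Soundness and conclusion -/

/-- Soundness of the calculus, cut included, for the interpretation in closed sets. -/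
theorem Derivation.interp_subset {Γ : Struct α} {A : Formula α} (d : Derivation Γ A) :
    Γ.interp ⊆ A.interp := by
  induction d with
  | id A => exact subset_rfl
  | top A => exact Set.subset_univ _
  | bot A => exact A.isCl_interp.cl_subset (Set.empty_subset _)
  | impL c Δ A B C _ _ h₁ h₂ =>
    refine (c.interp_fill_mono (Δ := .fm B) ?_).trans h₂
    exact (Struct.interp_odot_subset_iff B.isCl_interp).2 fun x hx y hy => hy x (h₁ hx)
  | impR Γ A B _ h =>
    exact fun y hy x hx => (Struct.interp_odot_subset_iff B.isCl_interp).1 h x hx y hy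
  | limpL c Δ A B C _ _ h₁ h₂ =>
    refine (c.interp_fill_mono (Δ := .fm A) ?_).trans h₁
    exact (Struct.interp_odot_subset_iff A.isCl_interp).2 fun x hx y hy => hx y (h₂ hy)
  | limpR Γ A B _ h =>
    exact fun x hx y hy => (Struct.interp_odot_subset_iff A.isCl_interp).1 h x hx y hy
  | prodL c A B C _ h =>
    exact (c.interp_fill_mono (Γ := .fm (.prod A B)) (Δ := .odot (.fm A) (.fm B)) subset_rfl).trans h
  | prodR Γ Δ A B _ _ h₁ h₂ =>
    exact (Struct.interp_odot_subset_iff (isCl_cl _)).2 fun x hx y hy =>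
      subset_cl _ ⟨x, h₁ hx, y, h₂ hy, rfl⟩
  | andL c A B C _ h =>
    exact (c.interp_fill_mono (Γ := .fm (.and A B)) (Δ := .owedge (.fm A) (.fm B)) subset_rfl).trans h
  | andR Γ A B _ _ h₁ h₂ => exact Set.subset_inter h₁ h₂
  | orL c A B C _ _ h₁ h₂ =>
    -- Monotonicity is not enough here: the context must preserve joins, and it does because it is
    -- residuated.
    obtain ⟨R, hR, h⟩ := c.exists_residual C.isCl_interp
    exact (h _).2 (hR.cl_subset (Set.union_subset ((h _).1 h₁) ((h _).1 h₂)))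
  | orR₁ Γ A B _ h => exact h.trans (Set.subset_union_left.trans (subset_cl _))
  | orR₂ Γ A B _ h => exact h.trans (Set.subset_union_right.trans (subset_cl _))
  | owedgeC c Δ A _ h =>
    exact (c.interp_fill_mono (Δ := .owedge Δ Δ) fun x hx => ⟨hx, hx⟩).trans h
  | odotC c Λ Δ A _ h =>
    refine (c.interp_fill_mono (Δ := .odot (.odot Λ Δ) Δ) ?_).trans h
    refine (Struct.interp_odot_subset_iff (Struct.isCl_interp _)).2 fun x hx y hy => ?_
    -- Contraction of analytic sequents passes membership from `(x ⊙ y) ⊙ y` to `x ⊙ y`.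
    refine (Struct.isCl_interp _).mem_of_forall (Γ := .odot (.odot x y) y) ?_
      fun c _ h => .odotC c h
    exact subset_cl _ ⟨_, subset_cl _ ⟨x, hx, y, hy, rfl⟩, y, hy, rfl⟩
  | owedgeE c Δ Λ A _ h =>
    exact (c.interp_fill_mono (Γ := .owedge Λ Δ) (Δ := .owedge Δ Λ)
      fun x hx => ⟨hx.2, hx.1⟩).trans h
  | cut c Δ A B _ _ h₁ h₂ => exact (c.interp_fill_mono (Δ := .fm A) h₁).trans h₂
  | owedgeW₁ c Δ' Δ A _ h => exact (c.interp_fill_mono Set.inter_subset_right).trans h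
  | odotW₁ c Δ' Δ A _ h =>
    refine (c.interp_fill_mono ?_).trans h
    exact (Struct.interp_odot_subset_iff Δ.isCl_interp).2 fun x _ y hy =>
      Δ.isCl_interp.mem_of_forall hy fun c _ h => .odotW₁ c x h
  | owedgeW₂ c Δ Δ' A _ h => exact (c.interp_fill_mono Set.inter_subset_left).trans h
  | odotW₂ c Δ Δ' A _ h =>
    refine (c.interp_fill_mono ?_).trans h
    exact (Struct.interp_odot_subset_iff Δ.isCl_interp).2 fun x hx y _ =>
      Δ.isCl_interp.mem_of_forall hx fun c _ h => .odotW₂ c y h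
  | owedgeA₁ c Δ₁ Δ₂ Δ₃ A _ h =>
    exact (c.interp_fill_mono (Set.inter_assoc _ _ _).ge).trans h
  | owedgeA₂ c Δ₁ Δ₂ Δ₃ A _ h =>
    exact (c.interp_fill_mono (Set.inter_assoc _ _ _).le).trans h

theorem Derivable.analytic {Γ : Struct α} {A : Formula α} (h : Derivable Γ A) : Analytic Γ A :=
  h.elim fun d => A.mem_interp_and_interp_subset.2 Γ (d.interp_subset Γ.mem_interp)

end RBL

theorem mainTheorem5 {α : Type*} (Γ : RBL.Struct α) (A : RBL.Formula α)
    (h : RBL.Derivable Γ A) :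
    ∃ d : RBL.Derivation Γ A, ∀ B ∈ d.formulas,
      B = RBL.Formula.top ∨ B = RBL.Formula.bot ∨
        (∃ C ∈ Γ.formulas, B ∈ C.subformulas) ∨ B ∈ A.subformulas := by
  obtain ⟨d, hd⟩ := h.analytic
  -- The separate alternatives for `⊤` and `⊥` are not needed: only subformulae of the end sequent
  -- occur.
  refine ⟨d, fun B hB => .inr (.inr ?_)⟩
  obtain ⟨C, hC | rfl, hBC⟩ := hd hB
  · exact .inl ⟨C, hC, hBC⟩
  · exact .inr hBC
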